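/- Let $M>0$ be a real number and let $D=\{z\in\mathbb{C}: |z|\le 1\}$ be the closed unit disk. For every integer $n\ge 1$ let $P_n(z)=\sum_{k=0}^n a_{k,n}z^k$ be a polynomial with integer coefficients of exact degree $n$ (that is, $a_{n,n}\ne 0$) such that all complex zeros of $P_n$ are simple and lie in $D$, and $|a_{n,n}|\le M$. Then $$\lim_{n\to\infty}\frac{|a_{n-1,n}|}{n}=0.$$ -/

import Mathlib

open Filter Topology Polynomial

/-- The polynomials with integer coefficients, of exact degree `n`, all of whose complex zeros
lie in `E`. -/
def integerPolys (n : ℕ) (E : Set ℂ) : Set ℤ[X] :=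
  {p | p.degree = (n : WithBot ℕ) ∧ ∀ z : ℂ, aeval z p = 0 → z ∈ E}

/-- The members of `integerPolys n E` all of whose complex zeros are simple. -/
def integerPolysSimple (n : ℕ) (E : Set ℂ) : Set ℤ[X] :=
  {p | p ∈ integerPolys n E ∧
    ∀ z : ℂ, aeval z p = 0 → (p.map (Int.castRingHom ℂ)).rootMultiplicity z = 1}

/-- The members of `integerPolysSimple n E` whose leading coefficient has absolute value
at most `M`. -/
def integerPolysSimpleBdd (n : ℕ) (E : Set ℂ) (M : ℝ) : Set ℤ[X] :=
  {p | p ∈ integerPolysSimple n E ∧ |(p.leadingCoeff : ℝ)| ≤ M}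

/-!
Write `z₁, …, zₙ` for the zeros of a polynomial `p` of degree `n` with leading coefficient `a`, so
that its next coefficient is `-a ∑ zᵢ`. The zeros of a polynomial as in the theorem repel each
other: the resultant of `p` and `p'` is a nonzero integer, which gives the lower bound
`∑_{i ≠ j} log |zᵢ - zⱼ| ≥ -2 n log |a|` (`one_le_leadingCoeff_pow_mul_prod_norm_sub`).

An upper bound comes from a smoothing of the logarithmic kernel. For `0 < ρ < 1` and `z, w` in the
closed unit disk, `ρ |z - w|² ≤ |1 - ρ z w̄|²`, and the larger kernel is negative definite:
`∑_{i, j} log |1 - ρ zᵢ z̄ⱼ| = -∑_{k ≥ 1} (ρ ^ k / k) |∑ zᵢ ^ k|² ≤ -ρ |∑ zᵢ|²`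
(`sum_sum_log_norm_one_sub_le`). The diagonal terms cost at most `-n log (1 - ρ)`, and replacing one
kernel by the other costs at most `-(n² / 2) log ρ` (`sum_sum_log_norm_sub_le`).

With `ρ = 1 - 1 / n` both costs are `O(n log n)`. Comparing the two bounds yields
`|∑ zᵢ|² = O(n log n)`, whence `|∑ zᵢ| / n → 0`.
-/

open scoped ComplexConjugate

/-- The smoothed logarithmic kernel `log ‖1 - ρ z w̄‖` is negative definite; the term of order one of
its power series alone bounds the energy of a finite set in terms of the sum of its points. -/
lemma sum_sum_log_norm_one_sub_le (s : Finset ℂ) (hs : ∀ z ∈ s, ‖z‖ ≤ 1) {ρ : ℝ} (h0 : 0 < ρ)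
    (h1 : ρ < 1) :
    ∑ z ∈ s, ∑ w ∈ s, Real.log ‖1 - ρ * z * conj w‖ ≤ -(ρ * ‖∑ z ∈ s, z‖ ^ 2) := by
  have hlt : ∀ z ∈ s, ∀ w ∈ s, ‖(ρ : ℂ) * z * conj w‖ < 1 := by
    intro z hz w hw
    rw [norm_mul, norm_mul, Complex.norm_real, Real.norm_of_nonneg h0.le, RCLike.norm_conj]
    have := mul_le_one₀ (hs z hz) (norm_nonneg w) (hs w hw)
    nlinarith
  have hsum := hasSum_sum fun z hz => hasSum_sum fun w hw =>
    Complex.hasSum_re (Complex.hasSum_taylorSeries_neg_log' (hlt z hz w hw))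
  have hterm : ∀ k : ℕ, ∑ z ∈ s, ∑ w ∈ s, (((ρ : ℂ) * z * conj w) ^ (k + 1) / ((k : ℂ) + 1)).re =
      ρ ^ (k + 1) / (k + 1) * ‖∑ z ∈ s, z ^ (k + 1)‖ ^ 2 := by
    intro k
    rw [← Complex.ofReal_re (ρ ^ (k + 1) / (k + 1) * ‖∑ z ∈ s, z ^ (k + 1)‖ ^ 2)]
    simp_rw [← Complex.re_sum]
    congr 1
    push_cast
    rw [← Complex.mul_conj', map_sum, Finset.sum_mul_sum, Finset.mul_sum]
    refine Finset.sum_congr rfl fun z _ => ?_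
    rw [Finset.mul_sum]
    refine Finset.sum_congr rfl fun w _ => ?_
    rw [map_pow]
    ring
  have hle := le_hasSum hsum 0 fun k _ => by
    rw [hterm]
    positivity
  rw [hterm] at hle
  simp only [Complex.neg_re, Complex.log_re, Finset.sum_neg_distrib] at hle
  norm_num at hle
  linarith

/-- The identity `‖1 - ρ z w̄‖² - ρ ‖z - w‖² = (1 - ρ ‖z‖²) (1 - ρ ‖w‖²)` shows that the smoothed
kernel dominates the logarithmic one up to a constant. -/
lemma log_norm_sub_le {z w : ℂ} (hz : ‖z‖ ≤ 1) (hw : ‖w‖ ≤ 1) (hzw : z ≠ w) {ρ : ℝ} (h0 : 0 < ρ)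
    (h1 : ρ < 1) :
    Real.log ‖z - w‖ ≤ Real.log ‖1 - ρ * z * conj w‖ - Real.log ρ / 2 := by
  have hzw' : 0 < ‖z - w‖ := norm_pos_iff.2 (sub_ne_zero.2 hzw)
  have hz2 : ‖z‖ ^ 2 ≤ 1 := pow_le_one₀ (norm_nonneg z) hz
  have hw2 : ‖w‖ ^ 2 ≤ 1 := pow_le_one₀ (norm_nonneg w) hw
  have hid : ‖1 - (ρ : ℂ) * z * conj w‖ ^ 2 =
      ρ * ‖z - w‖ ^ 2 + (1 - ρ * ‖z‖ ^ 2) * (1 - ρ * ‖w‖ ^ 2) := by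
    simp only [← Complex.normSq_eq_norm_sq, Complex.normSq_apply]
    simp
    ring
  have hle : ρ * ‖z - w‖ ^ 2 ≤ ‖1 - (ρ : ℂ) * z * conj w‖ ^ 2 := by
    have : 0 ≤ (1 - ρ * ‖z‖ ^ 2) * (1 - ρ * ‖w‖ ^ 2) :=
      mul_nonneg (by nlinarith) (by nlinarith)
    linarith
  have hlog := Real.log_le_log (by positivity) hle
  rw [Real.log_mul h0.ne' (by positivity), Real.log_pow, Real.log_pow] at hlog
  push_cast at hlog
  linarith

lemma sum_sum_log_norm_sub_le (s : Finset ℂ) (hs : ∀ z ∈ s, ‖z‖ ≤ 1) {ρ : ℝ} (h0 : 0 < ρ)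
    (h1 : ρ < 1) :
    ∑ z ∈ s, ∑ w ∈ s.erase z, Real.log ‖z - w‖ ≤
      -(ρ * ‖∑ z ∈ s, z‖ ^ 2) - s.card * Real.log (1 - ρ) - s.card ^ 2 * (Real.log ρ / 2) := by
  have hlogρ : Real.log ρ < 0 := Real.log_neg h0 h1
  have hrow : ∀ z ∈ s, ∑ w ∈ s.erase z, Real.log ‖z - w‖ ≤
      ∑ w ∈ s, Real.log ‖1 - (ρ : ℂ) * z * conj w‖ - Real.log (1 - ρ) -
        s.card * (Real.log ρ / 2) := by
    intro z hz
    have hoff : ∑ w ∈ s.erase z, Real.log ‖z - w‖ ≤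
        ∑ w ∈ s.erase z, (Real.log ‖1 - (ρ : ℂ) * z * conj w‖ - Real.log ρ / 2) :=
      Finset.sum_le_sum fun w hw => log_norm_sub_le (hs z hz) (hs w (Finset.mem_of_mem_erase hw))
        (Finset.ne_of_mem_erase hw).symm h0 h1
    have hdiag : Real.log (1 - ρ) ≤ Real.log ‖1 - (ρ : ℂ) * z * conj z‖ := by
      refine Real.log_le_log (by linarith) ?_
      have hz2 : ‖z‖ ^ 2 ≤ 1 := pow_le_one₀ (norm_nonneg z) (hs z hz)
      rw [mul_assoc, Complex.mul_conj']
      have hcast : (1 : ℂ) - ρ * (‖z‖ : ℂ) ^ 2 = ((1 - ρ * ‖z‖ ^ 2 : ℝ) : ℂ) := by push_cast; ring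
      rw [hcast, Complex.norm_real]
      refine le_trans ?_ (le_abs_self _)
      nlinarith
    have hcard : ((s.erase z).card : ℝ) ≤ s.card := by
      exact_mod_cast Finset.card_le_card (Finset.erase_subset z s)
    rw [Finset.sum_sub_distrib, Finset.sum_const, nsmul_eq_mul] at hoff
    have hsplit := Finset.add_sum_erase s
      (fun w => Real.log ‖1 - (ρ : ℂ) * z * conj w‖) hz
    nlinarith
  have htotal := Finset.sum_le_sum hrow
  simp only [Finset.sum_sub_distrib, Finset.sum_const, nsmul_eq_mul] at htotal
  have := sum_sum_log_norm_one_sub_le s hs h0 h1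
  linarith

/-- The resultant of an integer polynomial with simple zeros and its derivative is a nonzero
integer, so its absolute value is at least one. -/
lemma one_le_leadingCoeff_pow_mul_prod_norm_sub (p : ℤ[X]) (hp : p ≠ 0)
    (hnodup : (p.map (Int.castRingHom ℂ)).roots.Nodup) :
    1 ≤ |(p.leadingCoeff : ℝ)| ^ (2 * p.natDegree) *
      ∏ z ∈ (p.map (Int.castRingHom ℂ)).roots.toFinset,
        ∏ w ∈ (p.map (Int.castRingHom ℂ)).roots.toFinset.erase z, ‖z - w‖ := by
  set q := p.map (Int.castRingHom ℂ) with hq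
  have hinj : Function.Injective (Int.castRingHom ℂ) := Int.cast_injective
  have hdeg : q.natDegree = p.natDegree := natDegree_map_eq_of_injective hinj p
  have hlead : q.leadingCoeff = (p.leadingCoeff : ℂ) := by
    simpa using leadingCoeff_map_of_injective hinj p
  have hsplits : q.Splits := IsAlgClosed.splits q
  have hcard : q.roots.toFinset.card = p.natDegree := by
    rw [Multiset.toFinset_card_of_nodup hnodup, ← hsplits.natDegree_eq_card_roots, hdeg]
  have hderiv : ∀ z ∈ q.roots.toFinset, q.derivative.eval z =
      (p.leadingCoeff : ℂ) * ∏ w ∈ q.roots.toFinset.erase z, (z - w) := by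
    intro z hz
    have hzr : z ∈ q.roots := Multiset.mem_toFinset.1 hz
    conv_lhs => rw [hsplits.eq_prod_roots]
    rw [derivative_C_mul, eval_C_mul, eval_multiset_prod_X_sub_C_derivative hzr, hlead,
      Finset.prod, Finset.erase_val, Multiset.toFinset_val, hnodup.dedup]
  -- Giving `q.derivative` the formal degree `n` instead of `n - 1` only adds a factor of absolute
  -- value `|a|`, and avoids a truncated subtraction.
  have hres := resultant_eq_prod_eval q q.derivative p.natDegree
    ((natDegree_derivative_le q).trans (by omega)) hsplits
  have hprod : (q.roots.map fun z => q.derivative.eval z).prod =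
      ∏ z ∈ q.roots.toFinset, q.derivative.eval z := by
    rw [Finset.prod, Multiset.toFinset_val, hnodup.dedup]
  rw [hdeg, hlead, hprod, Finset.prod_congr rfl hderiv, Finset.prod_mul_distrib,
    Finset.prod_const, hcard, ← mul_assoc, ← pow_add, ← two_mul, hq, derivative_map,
    resultant_map_map, ← hq] at hres
  have hlead0 : (p.leadingCoeff : ℂ) ≠ 0 := by exact_mod_cast leadingCoeff_ne_zero.2 hp
  have hne : resultant p p.derivative p.natDegree p.natDegree ≠ 0 := by
    intro h
    rw [h, map_zero] at hres
    refine mul_ne_zero (pow_ne_zero _ hlead0) ?_ hres.symm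
    exact Finset.prod_ne_zero_iff.2 fun z _ => Finset.prod_ne_zero_iff.2 fun w hw =>
      sub_ne_zero.2 (Finset.ne_of_mem_erase hw).symm
  have hnorm := congrArg norm hres
  simp only [eq_intCast, norm_mul, norm_pow, norm_prod, Complex.norm_intCast] at hnorm
  rw [← hnorm]
  exact_mod_cast Int.one_le_abs hne

/-- The next coefficient is `O(√(n log n))`, by comparing the two bounds for the energy of the zeros
at `ρ = 1 - 1 / n`. -/
lemma sq_coeff_pred_le {M : ℝ} {n : ℕ} (hn : 2 ≤ n) {p : ℤ[X]}
    (hp : p ∈ integerPolysSimpleBdd n (Metric.closedBall (0 : ℂ) 1) M) :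
    (p.coeff (n - 1) : ℝ) ^ 2 ≤ M ^ 2 * (2 * n * (1 + Real.log n + 2 * Real.log M)) := by
  obtain ⟨⟨⟨hdeg, hroots⟩, hsimple⟩, hM⟩ := hp
  have hp0 : p ≠ 0 := by
    rintro rfl
    simp at hdeg
  have hnat : p.natDegree = n := natDegree_eq_of_degree_eq_some hdeg
  have hinj : Function.Injective (Int.castRingHom ℂ) := Int.cast_injective
  have hq0 : p.map (Int.castRingHom ℂ) ≠ 0 := (Polynomial.map_ne_zero_iff hinj).2 hp0
  have hmem : ∀ z ∈ (p.map (Int.castRingHom ℂ)).roots, aeval z p = 0 := by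
    intro z hz
    simpa [IsRoot, eval_map, aeval_def] using (mem_roots hq0).1 hz
  have hnodup : (p.map (Int.castRingHom ℂ)).roots.Nodup := by
    rw [Multiset.nodup_iff_count_le_one]
    intro z
    by_cases hz : z ∈ (p.map (Int.castRingHom ℂ)).roots
    · rw [count_roots, hsimple z (hmem z hz)]
    · simp [Multiset.count_eq_zero_of_notMem hz]
  have hlower := one_le_leadingCoeff_pow_mul_prod_norm_sub p hp0 hnodup
  have hsplits := IsAlgClosed.splits (p.map (Int.castRingHom ℂ))
  have hcard : (p.map (Int.castRingHom ℂ)).roots.toFinset.card = n := by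
    rw [Multiset.toFinset_card_of_nodup hnodup, ← hsplits.natDegree_eq_card_roots,
      natDegree_map_eq_of_injective hinj, hnat]
  have hcoeff : (p.coeff (n - 1) : ℂ) =
      -p.leadingCoeff * ∑ z ∈ (p.map (Int.castRingHom ℂ)).roots.toFinset, z := by
    have h := hsplits.nextCoeff_eq_neg_sum_roots_mul_leadingCoeff
    rw [nextCoeff_map hinj, leadingCoeff_map_of_injective hinj,
      nextCoeff_of_natDegree_pos (by omega), hnat] at h
    rw [Finset.sum, Multiset.toFinset_val, hnodup.dedup, Multiset.map_id']
    simpa using h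
  have hdisk : ∀ z ∈ (p.map (Int.castRingHom ℂ)).roots.toFinset, ‖z‖ ≤ 1 := fun z hz => by
    simpa using hroots z (hmem z (Multiset.mem_toFinset.1 hz))
  generalize (p.map (Int.castRingHom ℂ)).roots.toFinset = s at *
  have hn2 : (2 : ℝ) ≤ n := by exact_mod_cast hn
  have hn0 : (0 : ℝ) < n := by linarith
  have hlead : 0 < |(p.leadingCoeff : ℝ)| :=
    abs_pos.2 (by exact_mod_cast leadingCoeff_ne_zero.2 hp0)
  have hfactor : ∀ z ∈ s, ∀ w ∈ s.erase z, ‖z - w‖ ≠ 0 := fun z _ w hw =>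
    norm_ne_zero_iff.2 (sub_ne_zero.2 (Finset.ne_of_mem_erase hw).symm)
  have hrow : ∀ z ∈ s, ∏ w ∈ s.erase z, ‖z - w‖ ≠ 0 := fun z hz =>
    Finset.prod_ne_zero_iff.2 (hfactor z hz)
  have hlog := Real.log_nonneg hlower
  rw [Real.log_mul (by positivity) (Finset.prod_ne_zero_iff.2 hrow), Real.log_pow,
    Real.log_prod hrow, Finset.sum_congr rfl fun z hz => Real.log_prod (hfactor z hz), hnat] at hlog
  push_cast at hlog
  have hlogM : Real.log |(p.leadingCoeff : ℝ)| ≤ Real.log M := Real.log_le_log hlead hM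
  have hinv : (1 : ℝ) / n ≤ 1 / 2 := one_div_le_one_div_of_le (by norm_num) hn2
  have hinv0 : (0 : ℝ) < 1 / n := by positivity
  have hupper := sum_sum_log_norm_sub_le s hdisk (ρ := 1 - 1 / n) (by linarith) (by linarith)
  rw [hcard, sub_sub_cancel, one_div, Real.log_inv, ← one_div] at hupper
  have hlogρ : -Real.log (1 - 1 / (n : ℝ)) ≤ 2 / n := by
    have h := Real.one_sub_inv_le_log_of_pos (show (0 : ℝ) < 1 - 1 / n by linarith)
    have hle : (1 - 1 / (n : ℝ))⁻¹ ≤ 1 + 2 / n := by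
      rw [inv_le_iff_one_le_mul₀ (by linarith), show (2 : ℝ) / n = 2 * (1 / n) by ring]
      nlinarith
    linarith
  have hcost : (n : ℝ) ^ 2 * (-Real.log (1 - 1 / (n : ℝ)) / 2) ≤ n := by
    calc (n : ℝ) ^ 2 * (-Real.log (1 - 1 / (n : ℝ)) / 2) ≤ n ^ 2 * ((2 / n) / 2) := by gcongr
      _ = (n : ℝ) := by field_simp
  have hS : ‖∑ z ∈ s, z‖ ^ 2 ≤ 2 * n * (1 + Real.log n + 2 * Real.log M) := by
    have hhalf : (1 / 2 : ℝ) * ‖∑ z ∈ s, z‖ ^ 2 ≤ (1 - 1 / n) * ‖∑ z ∈ s, z‖ ^ 2 := by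
      gcongr
      linarith
    have hmul : (n : ℝ) * Real.log |(p.leadingCoeff : ℝ)| ≤ n * Real.log M := by gcongr
    nlinarith
  have hnorm := congrArg norm hcoeff
  rw [norm_mul, norm_neg, Complex.norm_intCast, Complex.norm_intCast] at hnorm
  rw [← sq_abs, hnorm, mul_pow]
  gcongr

theorem corollary2p4 (M : ℝ) (hM : 0 < M) (P : ℕ → ℤ[X])
    (hP : ∀ n : ℕ, 1 ≤ n → P n ∈ integerPolysSimpleBdd n (Metric.closedBall (0 : ℂ) 1) M) :
    Tendsto (fun n : ℕ => |((P n).coeff (n - 1) : ℝ)| / (n : ℝ)) atTop (𝓝 0) := by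
  have hlog : Tendsto (fun n : ℕ => Real.log n / (n : ℝ)) atTop (𝓝 0) :=
    Real.isLittleO_log_id_atTop.tendsto_div_nhds_zero.comp tendsto_natCast_atTop_atTop
  have hbound : Tendsto (fun n : ℕ => 2 * M ^ 2 * ((1 + 2 * Real.log M) / n + Real.log n / n))
      atTop (𝓝 0) := by
    simpa using ((tendsto_const_div_atTop_nhds_zero_nat (1 + 2 * Real.log M)).add hlog).const_mul
      (2 * M ^ 2)
  have hsq : Tendsto (fun n : ℕ => (|((P n).coeff (n - 1) : ℝ)| / (n : ℝ)) ^ 2) atTop (𝓝 0) := by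
    refine squeeze_zero' (.of_forall fun n => by positivity) ?_ hbound
    filter_upwards [eventually_ge_atTop 2] with n hn
    have hn0 : (0 : ℝ) < n := by exact_mod_cast (by omega : 0 < n)
    rw [div_pow, sq_abs, div_le_iff₀ (by positivity)]
    refine (sq_coeff_pred_le hn (hP n (by omega))).trans_eq ?_
    field_simp
    ring
  simpa [Real.sqrt_sq_eq_abs, abs_div] using hsq.sqrt
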